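/- Let $N\ge 2$, $T>0$, $\epsilon>0$, $\alpha\in(0,1)$ and $f:\{1,\dots,N\}\to(0,\infty)$, with $f_{\max}=\max_n f(n)$, $f_{\min}=\min_n f(n)$ and $\bar f=\frac1N\sum_{n=1}^N f(n)$. Assume that $$\min\Big\{\tfrac12\Big[N+1-\max_{1\le k\le N}\sqrt{\sum_{n\ne k}f(n)\sum_{n\neq k}\tfrac1{f(n)}}\Big],\,1\Big\}>\frac1{f_{\min}}\sqrt{\sum_{n=1}^N(f(n)-\bar f)^2}+\frac{f_{\max}-f_{\min}}{f_{\min}}.$$ Let $\sigma:[0,\infty)\times\mathbb R\to\mathbb R$ be smooth with all derivatives bounded and $\sigma_0\le\sigma\le\sigma_1$ for some constants $0<\sigma_0<\sigma_1$. Let $P_1,\dots,P_N:\mathbb R\to[0,\infty)$ be integrable functions with $\int P_n\,dx=m_n$ and $\sum_{n=1}^N m_n=1$ (that is, $P_n(x)\,dx=\mathbb P(X_0\in dx,\,Y=n)$ and $m_n=\mathbb P(Y=n)$ for some pair $(X_0,Y)$ of random variables), such that each $P_n$ belongs to $C^{2+\alpha}(\mathbb R)$: $P_n$ is twice continuously differentiable,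 and $P_n,P_n',P_n''$ are bounded and $\alpha$-Hölder. For $\beta\in(0,1)$ let $C^{1+\beta/2,2+\beta}$ be the space of functions $\phi$ on $[0,T]\times\mathbb R$ for which $\phi,\partial_x\phi,\partial_{xx}\phi,\partial_t\phi$ exist (with one-sided time derivatives at $t=0$ and $t=T$), are continuous and bounded, and such that, on $[0,T]\times\mathbb R$, $\partial_x\phi$ is $\frac{1+\beta}2$-Hölder in $t$ uniformly in $x$, and $\partial_{xx}\phi$ and $\partial_t\phi$ are $\frac\beta2$-Hölder in $t$ uniformly in $x$ and $\beta$-Hölder in $x$ uniformly in $t$. Then there is at most one $p=(p_1,\dots,p_N)\in\big(C^{1+\alpha/4,2+\alpha/2}\big)^N$ such that, for all $1\le n\le N$, $$\partial_t p_n=\tfrac12\partial_{xx}\big[\sigma^2B_n^\epsilon(p)p_n\big]+\tfrac12\partial_x\big[\sigma^2B_n^\epsilon(p)p_n\big]\ \text{ on }[0,T]\times\mathbb R,\qquad B^\epsilon_n(u)=\frac{\epsilon+f(n)\sum_{k=1}^N u_k}{\epsilon+\sum_{k=1}^N f(k)u_k},$$ $p_n(0,\cdot)=P_n$, and, for every $t\in[0,T]$,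 $p_n(t,\cdot)\ge0$ is integrable with $\int p_n(t,x)\,dx=m_n$ (for $m_n>0$: $p_n(t,\cdot)/m_n$ is a probability density). -/

import Mathlib

open scoped ContDiff

noncomputable section

namespace LSV

/-- The time derivative on `[0,T]` (one-sided at the end points). -/
def dt (T : ℝ) (φ : ℝ → ℝ → ℝ) (t x : ℝ) : ℝ :=
  derivWithin (fun s => φ s x) (Set.Icc 0 T) t

/-- The space derivative. -/
def dx (φ : ℝ → ℝ → ℝ) (t x : ℝ) : ℝ :=
  deriv (φ t) x

/-- `φ` is bounded on `[0,T] × ℝ`. -/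
def BoundedStrip (T : ℝ) (φ : ℝ → ℝ → ℝ) : Prop :=
  ∃ C : ℝ, ∀ t ∈ Set.Icc 0 T, ∀ x : ℝ, |φ t x| ≤ C

/-- `φ` is continuous on `[0,T] × ℝ`. -/
def ContStrip (T : ℝ) (φ : ℝ → ℝ → ℝ) : Prop :=
  ContinuousOn (fun z : ℝ × ℝ => φ z.1 z.2) (Set.Icc 0 T ×ˢ Set.univ)

/-- `φ` is `γ`-Hölder in time on `[0,T]`, uniformly in space. -/
def TimeHolder (T γ : ℝ) (φ : ℝ → ℝ → ℝ) : Prop :=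
  ∃ C : ℝ, ∀ t ∈ Set.Icc 0 T, ∀ s ∈ Set.Icc 0 T, ∀ x : ℝ,
    |φ t x - φ s x| ≤ C * |t - s| ^ γ

/-- `φ` is `γ`-Hölder in space, uniformly in time on `[0,T]`. -/
def SpaceHolder (T γ : ℝ) (φ : ℝ → ℝ → ℝ) : Prop :=
  ∃ C : ℝ, ∀ t ∈ Set.Icc 0 T, ∀ x y : ℝ, |φ t x - φ t y| ≤ C * |x - y| ^ γ

/-- The parabolic Hölder space `C^{(2+β)/2, 2+β}` of functions on `[0,T] × ℝ`: the derivatives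
`∂_t^r ∂_x^l φ` with `2r + l ≤ 2` exist, are continuous and bounded, and satisfy the
Hölder bounds that make the parabolic Hölder norm finite. Values of `φ` at times outside
`[0,T]` play no role. -/
structure ParabolicHolder (T β : ℝ) (φ : ℝ → ℝ → ℝ) : Prop where
  diff_t : ∀ t ∈ Set.Icc 0 T, ∀ x : ℝ,
    DifferentiableWithinAt ℝ (fun s => φ s x) (Set.Icc 0 T) t
  diff_x : ∀ t ∈ Set.Icc 0 T, Differentiable ℝ (φ t)
  diff_xx : ∀ t ∈ Set.Icc 0 T, Differentiable ℝ (dx φ t)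
  cont : ContStrip T φ
  cont_x : ContStrip T (dx φ)
  cont_xx : ContStrip T (dx (dx φ))
  cont_t : ContStrip T (dt T φ)
  bdd : BoundedStrip T φ
  bdd_x : BoundedStrip T (dx φ)
  bdd_xx : BoundedStrip T (dx (dx φ))
  bdd_t : BoundedStrip T (dt T φ)
  timeHolder_x : TimeHolder T ((1 + β) / 2) (dx φ)
  timeHolder_xx : TimeHolder T (β / 2) (dx (dx φ))
  timeHolder_t : TimeHolder T (β / 2) (dt T φ)
  spaceHolder_xx : SpaceHolder T β (dx (dx φ))
  spaceHolder_t : SpaceHolder T β (dt T φ)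

/-- The Hölder space `C^{2+α}` on the real line. -/
def HolderTwo (α : ℝ) (φ : ℝ → ℝ) : Prop :=
  ContDiff ℝ 2 φ ∧ ∀ k ≤ 2,
    (∃ C : ℝ, ∀ x, |iteratedDeriv k φ x| ≤ C) ∧
    ∃ C : ℝ, ∀ x y, |iteratedDeriv k φ x - iteratedDeriv k φ y| ≤ C * |x - y| ^ α

/-- `σ` is smooth on `[0,∞) × ℝ`, all its derivatives are bounded there, and it takes values
between two positive constants. -/
structure VolatilityAssumption (σ : ℝ → ℝ → ℝ) : Prop where
  smooth : ContDiffOn ℝ ∞ (Function.uncurry σ) (Set.Ici 0 ×ˢ Set.univ)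
  bdd_deriv : ∀ k : ℕ, 1 ≤ k → ∃ C : ℝ, ∀ z ∈ (Set.Ici 0 ×ˢ Set.univ : Set (ℝ × ℝ)),
    ‖iteratedFDerivWithin ℝ k (Function.uncurry σ) (Set.Ici 0 ×ˢ Set.univ) z‖ ≤ C
  bounds : ∃ σ₀ σ₁ : ℝ, 0 < σ₀ ∧ σ₀ < σ₁ ∧ ∀ t, 0 ≤ t → ∀ x, σ₀ ≤ σ t x ∧ σ t x ≤ σ₁

variable {N : ℕ}

/-- The arithmetic mean of the values of `f`. -/
def fbar (f : Fin N → ℝ) : ℝ := (∑ n, f n) / N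

/-- The largest value of `f`. -/
def fmax (f : Fin N → ℝ) : ℝ := ⨆ n, f n

/-- The smallest value of `f`. -/
def fmin (f : Fin N → ℝ) : ℝ := ⨅ n, f n

/-- The small range condition on `f`. -/
def SmallRange (f : Fin N → ℝ) : Prop :=
  min (1 / 2 * ((N : ℝ) + 1 -
      ⨆ k : Fin N, √((∑ n ∈ Finset.univ.erase k, f n) * ∑ n ∈ Finset.univ.erase k, 1 / f n))) 1
    > 1 / fmin f * √(∑ n, (f n - fbar f) ^ 2) + (fmax f - fmin f) / fmin f

/-- The diagonal coefficient `B^ε_n(u) = (ε + f(n) ∑ u_k) / (ε + ∑ f(k) u_k)`. -/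
def B (ε : ℝ) (f : Fin N → ℝ) (u : Fin N → ℝ) (n : Fin N) : ℝ :=
  (ε + f n * ∑ k, u k) / (ε + ∑ k, f k * u k)

/-- The function `σ² B^ε_n(p) p_n`. -/
def flux (ε : ℝ) (f : Fin N → ℝ) (σ : ℝ → ℝ → ℝ) (p : Fin N → ℝ → ℝ → ℝ) (n : Fin N)
    (t x : ℝ) : ℝ :=
  σ t x ^ 2 * B ε f (fun k => p k t x) n * p n t x

/-- `P_n` are the densities of a probability law on `ℝ × {1,…,N}` (that of `(X₀, Y)`) whose second
marginal (the law of `Y`) gives mass `m n` to `n`. -/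
structure InitialDensities (m : Fin N → ℝ) (P : Fin N → ℝ → ℝ) : Prop where
  nonneg : ∀ n x, 0 ≤ P n x
  integrable : ∀ n, MeasureTheory.Integrable (P n)
  mass : ∀ n, ∫ x, P n x = m n
  total : ∑ n, m n = 1

/-- `p` solves, in the classical sense on `[0,T] × ℝ`, the system
`∂_t p = ½ ∂_xx[σ² B^ε(p) p] + ½ ∂_x[σ² B^ε(p) p]` with initial value `P`, and `p_n(t,·) / m_n` is
a probability density for every `t`: the last requirement is written multiplied by `m_n`, so that
it also makes sense for `m_n = 0`. -/
structure IsSolution (T ε : ℝ) (f : Fin N → ℝ) (σ : ℝ → ℝ → ℝ) (m : Fin N → ℝ)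
    (P : Fin N → ℝ → ℝ) (p : Fin N → ℝ → ℝ → ℝ) : Prop where
  pde : ∀ n, ∀ t ∈ Set.Icc 0 T, ∀ x : ℝ,
    dt T (p n) t x = 1 / 2 * dx (dx (flux ε f σ p n)) t x + 1 / 2 * dx (flux ε f σ p n) t x
  nonneg : ∀ n, ∀ t ∈ Set.Icc 0 T, ∀ x : ℝ, 0 ≤ p n t x
  integrable : ∀ n, ∀ t ∈ Set.Icc 0 T, MeasureTheory.Integrable (p n t)
  mass : ∀ n, ∀ t ∈ Set.Icc 0 T, ∫ x, p n t x = m n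
  init : ∀ n x, p n 0 x = P n x

end LSV

end

/-!
Since `∑ₙ Bₙ(u) uₙ = ∑ₙ uₙ`, the total density of a solution solves a linear parabolic equation and
is therefore determined by its initial value. Hence the difference `w` of two solutions, and with
it `∂ₓw`, takes values in the vectors of zero sum. The system is in divergence form,
`∂ₜp = ∂ₓ(½σ² DΦ(p) ∂ₓp + (σ ∂ₓσ + ½σ²) Φ(p))` with `Φ(u)ₙ = Bₙ(u) uₙ`, and on vectors of zero sum
the small range condition makes `DΦ(u)` coercive: the part of `⟪ξ, DΦ(u) ξ⟫` that survives `ε = 0`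
is affine in `f u`, hence controlled by one inequality for each coordinate direction, and the part
proportional to `ε` is controlled by the variance of `f`. Differentiating the energy
`∫ |w|² / (1 + x²) dx` then gives a Grönwall inequality. The weight is needed for bounded functions
to have finite energy; its derivative is bounded by the weight itself, so that it only costs terms
of the order of the energy.
-/

namespace LSV

open MeasureTheory Set
open scoped RealInnerProductSpace Topology

section Weight

/-- The weight `ρ` of the energy `∫ ρ ‖w‖²`: integrable, so that bounded functions have finite
energy, and with `|ρ'| ≤ ρ`, so that the terms produced by differentiating it are absorbed. -/
noncomputable def weight (x : ℝ) : ℝ := (1 + x ^ 2)⁻¹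

theorem weight_pos (x : ℝ) : 0 < weight x := by
  unfold weight
  positivity

theorem integrable_weight : Integrable weight := integrable_inv_one_add_sq

theorem hasDerivAt_weight (x : ℝ) : HasDerivAt weight (-(2 * x) / (1 + x ^ 2) ^ 2) x := by
  have h : HasDerivAt (fun y : ℝ => 1 + y ^ 2) (2 * x) x := by
    simpa using (hasDerivAt_pow 2 x).const_add 1
  exact h.fun_inv (by positivity)

theorem differentiable_weight : Differentiable ℝ weight := fun x =>
  (hasDerivAt_weight x).differentiableAt

theorem abs_deriv_weight_le (x : ℝ) : |deriv weight x| ≤ weight x := by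
  have h₀ : 0 < 1 + x ^ 2 := by positivity
  rw [(hasDerivAt_weight x).deriv, weight, abs_div, abs_neg, abs_of_pos (pow_pos h₀ 2),
    div_le_iff₀ (pow_pos h₀ 2), pow_two (1 + x ^ 2), inv_mul_cancel_left₀ h₀.ne', abs_le]
  constructor <;> nlinarith [sq_nonneg (x - 1), sq_nonneg (x + 1)]

theorem integrable_weight_mul {g : ℝ → ℝ} (hg : StronglyMeasurable g) {C : ℝ}
    (hC : ∀ x, |g x| ≤ C) : Integrable fun x => weight x * g x :=
  integrable_weight.mul_bdd hg.aestronglyMeasurable (.of_forall hC)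

theorem integrable_deriv_weight_mul {g : ℝ → ℝ} (hg : StronglyMeasurable g) {C : ℝ}
    (hC : ∀ x, |g x| ≤ C) : Integrable fun x => deriv weight x * g x :=
  (integrable_weight.mono' (stronglyMeasurable_deriv _).aestronglyMeasurable
    (.of_forall abs_deriv_weight_le)).mul_bdd hg.aestronglyMeasurable (.of_forall hC)

end Weight

/-- Grönwall's inequality; the versions in the library also ask for a derivative at the left end
point. -/
theorem nonpos_of_hasDerivAt_le_mul {T K : ℝ} {E E' : ℝ → ℝ} (hE : ContinuousOn E (Icc 0 T))
    (hE' : ∀ t ∈ Ioo 0 T, HasDerivAt E (E' t) t) (hle : ∀ t ∈ Ioo 0 T, E' t ≤ K * E t)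
    (hE₀ : E 0 ≤ 0) {t : ℝ} (ht : t ∈ Icc 0 T) : E t ≤ 0 := by
  have hexp : ∀ t ∈ Ioo 0 T, HasDerivAt (fun t => Real.exp (-K * t) * E t)
      (Real.exp (-K * t) * (E' t - K * E t)) t := fun t ht => by
    have hd : HasDerivAt (fun t => Real.exp (-K * t)) (Real.exp (-K * t) * -K) t := by
      simpa using ((hasDerivAt_id t).const_mul (-K)).exp
    exact (hd.mul (hE' t ht)).congr_deriv (by ring)
  have hanti : AntitoneOn (fun t => Real.exp (-K * t) * E t) (Icc 0 T) := by
    refine antitoneOn_of_hasDerivWithinAt_nonpos (convex_Icc 0 T)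
      (f' := fun t => Real.exp (-K * t) * (E' t - K * E t))
      ((by fun_prop : Continuous fun t => Real.exp (-K * t)).continuousOn.mul hE) ?_ ?_ <;>
      rw [interior_Icc]
    · exact fun t ht => (hexp t ht).hasDerivWithinAt
    · exact fun t ht => mul_nonpos_of_nonneg_of_nonpos (Real.exp_pos _).le
        (sub_nonpos.2 (hle t ht))
  have h := hanti ⟨le_rfl, ht.1.trans ht.2⟩ ht ht.1
  simp only [mul_zero, Real.exp_zero, one_mul] at h
  exact nonpos_of_mul_nonpos_right (h.trans hE₀) (Real.exp_pos _)

section Energy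

variable {E : Type*} [NormedAddCommGroup E] [InnerProductSpace ℝ E]

theorem abs_inner_le_mul {v w : E} {a b : ℝ} (hv : ‖v‖ ≤ a) (hw : ‖w‖ ≤ b) : |⟪v, w⟫| ≤ a * b :=
  (abs_real_inner_le_norm v w).trans
    (mul_le_mul hv hw (norm_nonneg w) ((norm_nonneg v).trans hv))

/-- Young's inequality absorbs the product `‖w‖ ‖ξ‖` into the coercive term. -/
theorem neg_mul_inner_add_le {c C ρ ρ' : ℝ} (hc : 0 < c) (hρ : |ρ'| ≤ ρ) {w ξ g : E}
    (hg : ‖g‖ ≤ C * (‖w‖ + ‖ξ‖)) (hcoer : c * ‖ξ‖ ^ 2 - C * ‖w‖ * ‖ξ‖ ≤ ⟪ξ, g⟫) :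
    -(ρ * ⟪ξ, g⟫ + ρ' * ⟪w, g⟫) ≤ (C ^ 2 / c + C) * (ρ * ‖w‖ ^ 2) := by
  have hρ₀ : 0 ≤ ρ := (abs_nonneg ρ').trans hρ
  have hlower : -(ρ' * ⟪w, g⟫) ≤ ρ * (‖w‖ * (C * (‖w‖ + ‖ξ‖))) := by
    refine (neg_le_abs _).trans ?_
    rw [abs_mul]
    exact mul_le_mul hρ (abs_inner_le_mul le_rfl hg) (abs_nonneg _) hρ₀
  have hyoung : 2 * C * ‖w‖ * ‖ξ‖ - c * ‖ξ‖ ^ 2 ≤ C ^ 2 / c * ‖w‖ ^ 2 := by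
    have hsq : 0 ≤ (c * ‖ξ‖ - C * ‖w‖) ^ 2 / c := by positivity
    have hexpand : (c * ‖ξ‖ - C * ‖w‖) ^ 2 / c
        = c * ‖ξ‖ ^ 2 - 2 * C * ‖w‖ * ‖ξ‖ + C ^ 2 / c * ‖w‖ ^ 2 := by
      field_simp
      ring
    linarith
  linarith [mul_le_mul_of_nonneg_left hcoer hρ₀, mul_le_mul_of_nonneg_left hyoung hρ₀]

/-- `w` is a function on `[0,T] × ℝ`, bounded together with its derivatives `wₜ` and `wₓ`, that
satisfies `∂ₜw = ∂ₓG` for a current `G` which is coercive in `wₓ` up to terms of order `w`. -/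
structure IsDissipative (T c C M : ℝ) (w wₜ wₓ G : ℝ → ℝ → E) : Prop where
  continuousOn_time : ∀ x, ContinuousOn (fun s => w s x) (Icc 0 T)
  hasDerivAt_time : ∀ t ∈ Ioo 0 T, ∀ x, HasDerivAt (fun s => w s x) (wₜ t x) t
  hasDerivAt_space : ∀ t ∈ Icc 0 T, ∀ x, HasDerivAt (w t) (wₓ t x) x
  hasDerivAt_current : ∀ t ∈ Icc 0 T, ∀ x, HasDerivAt (G t) (wₜ t x) x
  norm_le : ∀ t ∈ Icc 0 T, ∀ x, ‖w t x‖ ≤ M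
  norm_time_le : ∀ t ∈ Icc 0 T, ∀ x, ‖wₜ t x‖ ≤ M
  norm_space_le : ∀ t ∈ Icc 0 T, ∀ x, ‖wₓ t x‖ ≤ M
  norm_current_le : ∀ t ∈ Icc 0 T, ∀ x, ‖G t x‖ ≤ C * (‖w t x‖ + ‖wₓ t x‖)
  coercive : ∀ t ∈ Icc 0 T, ∀ x,
    c * ‖wₓ t x‖ ^ 2 - C * ‖w t x‖ * ‖wₓ t x‖ ≤ ⟪wₓ t x, G t x⟫

/-- The weighted `L²` energy `∫ ρ ‖w(t,·)‖²` of a bounded function. -/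
noncomputable def energy (w : ℝ → ℝ → E) (t : ℝ) : ℝ := ∫ x, weight x * ‖w t x‖ ^ 2

namespace IsDissipative

variable {T c C M : ℝ} {w wₜ wₓ G : ℝ → ℝ → E} {t : ℝ}

theorem continuous (h : IsDissipative T c C M w wₜ wₓ G) (ht : t ∈ Icc 0 T) :
    Continuous (w t) :=
  continuous_iff_continuousAt.2 fun x => (h.hasDerivAt_space t ht x).continuousAt

theorem continuous_current (h : IsDissipative T c C M w wₜ wₓ G) (ht : t ∈ Icc 0 T) :
    Continuous (G t) :=
  continuous_iff_continuousAt.2 fun x => (h.hasDerivAt_current t ht x).continuousAt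

theorem abs_norm_sq_le (h : IsDissipative T c C M w wₜ wₓ G) (ht : t ∈ Icc 0 T) (x : ℝ) :
    |‖w t x‖ ^ 2| ≤ M ^ 2 := by
  rw [abs_of_nonneg (sq_nonneg _)]
  exact pow_le_pow_left₀ (norm_nonneg _) (h.norm_le t ht x) 2

theorem integrable_energy (h : IsDissipative T c C M w wₜ wₓ G) (ht : t ∈ Icc 0 T) :
    Integrable fun x => weight x * ‖w t x‖ ^ 2 :=
  integrable_weight_mul ((h.continuous ht).norm.pow 2).stronglyMeasurable (h.abs_norm_sq_le ht)

theorem continuousOn_energy (h : IsDissipative T c C M w wₜ wₓ G) :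
    ContinuousOn (energy w) (Icc 0 T) := by
  refine continuousOn_of_dominated (bound := fun x => weight x * M ^ 2)
    (fun t ht => (h.integrable_energy ht).aestronglyMeasurable)
    (fun t ht => .of_forall fun x => ?_) (integrable_weight.mul_const _)
    (.of_forall fun x => continuousOn_const.mul ((h.continuousOn_time x).norm.pow 2))
  rw [norm_mul, Real.norm_of_nonneg (weight_pos x).le]
  exact mul_le_mul_of_nonneg_left (h.abs_norm_sq_le ht x) (weight_pos x).le

theorem norm_current_le_const (h : IsDissipative T c C M w wₜ wₓ G) (ht : t ∈ Icc 0 T) (x : ℝ) :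
    ‖G t x‖ ≤ |C| * (M + M) :=
  (h.norm_current_le t ht x).trans <| mul_le_mul (le_abs_self C)
    (add_le_add (h.norm_le t ht x) (h.norm_space_le t ht x)) (by positivity) (abs_nonneg C)

section Complete

variable [CompleteSpace E]

theorem stronglyMeasurable_space (h : IsDissipative T c C M w wₜ wₓ G) (ht : t ∈ Icc 0 T) :
    StronglyMeasurable (wₓ t) := by
  rw [← funext fun x => (h.hasDerivAt_space t ht x).deriv]
  exact stronglyMeasurable_deriv _

theorem stronglyMeasurable_time (h : IsDissipative T c C M w wₜ wₓ G) (ht : t ∈ Icc 0 T) :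
    StronglyMeasurable (wₜ t) := by
  rw [← funext fun x => (h.hasDerivAt_current t ht x).deriv]
  exact stronglyMeasurable_deriv _

theorem integrable_weight_mul_inner_time (h : IsDissipative T c C M w wₜ wₓ G)
    (ht : t ∈ Icc 0 T) : Integrable fun x => weight x * ⟪w t x, wₜ t x⟫ :=
  integrable_weight_mul ((h.continuous ht).stronglyMeasurable.inner (h.stronglyMeasurable_time ht))
    fun x => abs_inner_le_mul (h.norm_le t ht x) (h.norm_time_le t ht x)

theorem hasDerivAt_energy (h : IsDissipative T c C M w wₜ wₓ G) (ht : t ∈ Ioo 0 T) :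
    HasDerivAt (energy w) (2 * ∫ x, weight x * ⟪w t x, wₜ t x⟫) t := by
  have hsub : Ioo 0 T ⊆ Icc 0 T := Ioo_subset_Icc_self
  have hnhds : Ioo 0 T ∈ 𝓝 t := Ioo_mem_nhds ht.1 ht.2
  rw [← integral_const_mul]
  refine (hasDerivAt_integral_of_dominated_loc_of_deriv_le
    (F := fun s x => weight x * ‖w s x‖ ^ 2)
    (F' := fun s x => 2 * (weight x * ⟪w s x, wₜ s x⟫))
    (bound := fun x => 2 * (weight x * (M * M))) hnhds
    (Filter.mem_of_superset hnhds fun s hs => (h.integrable_energy (hsub hs)).aestronglyMeasurable)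
    (h.integrable_energy (hsub ht))
    ((h.integrable_weight_mul_inner_time (hsub ht)).const_mul 2).aestronglyMeasurable
    (.of_forall fun x s hs => ?_) ((integrable_weight.mul_const _).const_mul 2)
    (.of_forall fun x s hs => ?_)).2
  · rw [norm_mul, norm_mul, Real.norm_of_nonneg zero_le_two, Real.norm_of_nonneg (weight_pos x).le]
    have hinner := abs_inner_le_mul (h.norm_le s (hsub hs) x) (h.norm_time_le s (hsub hs) x)
    exact mul_le_mul_of_nonneg_left (mul_le_mul_of_nonneg_left hinner (weight_pos x).le) zero_le_two
  · exact ((h.hasDerivAt_time s hs x).norm_sq.const_mul (weight x)).congr_deriv (by ring)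

theorem integral_weight_mul_inner_time (h : IsDissipative T c C M w wₜ wₓ G)
    (ht : t ∈ Icc 0 T) :
    Integrable (fun x => weight x * ⟪wₓ t x, G t x⟫ + deriv weight x * ⟪w t x, G t x⟫) ∧
      ∫ x, weight x * ⟪w t x, wₜ t x⟫
        = -∫ x, (weight x * ⟪wₓ t x, G t x⟫ + deriv weight x * ⟪w t x, G t x⟫) := by
  have hw := (h.continuous ht).stronglyMeasurable
  have hG := (h.continuous_current ht).stronglyMeasurable
  have hwG : ∀ x, |⟪w t x, G t x⟫| ≤ M * (|C| * (M + M)) := fun x =>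
    abs_inner_le_mul (h.norm_le t ht x) (h.norm_current_le_const ht x)
  have hspace : Integrable fun x => weight x * ⟪wₓ t x, G t x⟫ :=
    integrable_weight_mul ((h.stronglyMeasurable_space ht).inner hG) fun x =>
      abs_inner_le_mul (h.norm_space_le t ht x) (h.norm_current_le_const ht x)
  have hweight := integrable_deriv_weight_mul (hw.inner hG) hwG
  have htime := h.integrable_weight_mul_inner_time ht
  have hsum : Integrable fun x =>
      weight x * ⟪wₓ t x, G t x⟫ + deriv weight x * ⟪w t x, G t x⟫ := hspace.add hweight
  refine ⟨hsum, eq_neg_of_add_eq_zero_left ?_⟩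
  rw [← integral_add htime hsum]
  refine integral_eq_zero_of_hasDerivAt_of_integrable (f := fun x => weight x * ⟪w t x, G t x⟫)
    (fun x => ?_) (htime.add hsum) (integrable_weight_mul (hw.inner hG) hwG)
  refine ((differentiable_weight x).hasDerivAt.mul ((h.hasDerivAt_space t ht x).inner ℝ
    (h.hasDerivAt_current t ht x))).congr_deriv ?_
  ring

theorem integral_inner_time_le (h : IsDissipative T c C M w wₜ wₓ G) (hc : 0 < c)
    (ht : t ∈ Icc 0 T) :
    ∫ x, weight x * ⟪w t x, wₜ t x⟫ ≤ (C ^ 2 / c + C) * energy w t := by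
  obtain ⟨hint, hparts⟩ := h.integral_weight_mul_inner_time ht
  rw [hparts, ← integral_neg, energy, ← integral_const_mul]
  exact integral_mono hint.neg ((h.integrable_energy ht).const_mul _) fun x =>
    neg_mul_inner_add_le hc (abs_deriv_weight_le x) (h.norm_current_le t ht x) (h.coercive t ht x)

theorem eq_zero (h : IsDissipative T c C M w wₜ wₓ G) (hc : 0 < c) (h₀ : ∀ x, w 0 x = 0)
    (ht : t ∈ Icc 0 T) (x : ℝ) : w t x = 0 := by
  have hnonpos : energy w t ≤ 0 :=
    nonpos_of_hasDerivAt_le_mul (K := 2 * (C ^ 2 / c + C)) h.continuousOn_energy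
      (fun s hs => h.hasDerivAt_energy hs)
      (fun s hs => by linarith [h.integral_inner_time_le hc (Ioo_subset_Icc_self hs)])
      (by simp [energy, h₀]) ht
  have hnonneg : ∀ x, 0 ≤ weight x * ‖w t x‖ ^ 2 := fun x =>
    mul_nonneg (weight_pos x).le (sq_nonneg _)
  have hzero : energy w t = 0 := hnonpos.antisymm (integral_nonneg hnonneg)
  have hcont : Continuous fun x => weight x * ‖w t x‖ ^ 2 :=
    differentiable_weight.continuous.mul ((h.continuous ht).norm.pow 2)
  have hae := (integral_eq_zero_iff_of_nonneg hnonneg (h.integrable_energy ht)).1 hzero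
  have hx := congrFun ((hcont.ae_eq_iff_eq volume continuous_zero).1 hae) x
  exact norm_eq_zero.1 (sq_eq_zero_iff.1 ((mul_eq_zero_iff_left (weight_pos x).ne').1 hx))

end Complete

end IsDissipative

end Energy

theorem exists_lipschitzOnWith_fderiv {E F : Type*} [NormedAddCommGroup E] [NormedSpace ℝ E]
    [NormedAddCommGroup F] [NormedSpace ℝ F] {Φ : E → F} {K : Set E} (hK : IsCompact K)
    (hΦ : ∀ z ∈ K, ContDiffAt ℝ 2 Φ z) :
    ∃ L : NNReal, LipschitzOnWith L Φ K ∧ LipschitzOnWith L (fderiv ℝ Φ) K ∧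
      ∀ z ∈ K, ‖fderiv ℝ Φ z‖ ≤ L := by
  have hderiv : ∀ z ∈ K, ContDiffAt ℝ 1 (fderiv ℝ Φ) z := fun z hz =>
    (hΦ z hz).fderiv_right (by norm_num)
  have hcont : ContinuousOn (fderiv ℝ Φ) K := fun z hz =>
    (hderiv z hz).continuousAt.continuousWithinAt
  obtain ⟨L₀, hL₀⟩ := LocallyLipschitzOn.exists_lipschitzOnWith_of_compact (f := Φ) hK
    fun z hz => by
      obtain ⟨L, s, hs, hL⟩ := ((hΦ z hz).of_le one_le_two).exists_lipschitzOnWith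
      exact ⟨L, s, mem_nhdsWithin_of_mem_nhds hs, hL⟩
  obtain ⟨L₁, hL₁⟩ := LocallyLipschitzOn.exists_lipschitzOnWith_of_compact (f := fderiv ℝ Φ) hK
    fun z hz => by
      obtain ⟨L, s, hs, hL⟩ := (hderiv z hz).exists_lipschitzOnWith
      exact ⟨L, s, mem_nhdsWithin_of_mem_nhds hs, hL⟩
  obtain ⟨L₂, hL₂⟩ := hK.exists_bound_of_continuousOn hcont
  refine ⟨L₀ ⊔ L₁ ⊔ L₂.toNNReal, hL₀.weaken (le_sup_left.trans le_sup_left),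
    hL₁.weaken (le_sup_right.trans le_sup_left), fun z hz => (hL₂ z hz).trans ?_⟩
  exact (Real.le_coe_toNNReal L₂).trans (NNReal.coe_le_coe.2 le_sup_right)

section Quasilinear

section Equation

variable {E F : Type*} [NormedAddCommGroup E] [NormedSpace ℝ E] [NormedAddCommGroup F]
  [NormedSpace ℝ F]

/-- The current of the quasilinear parabolic equation `∂ₜu = ∂ₓ(a DΦ(u) ∂ₓu + b Φ(u))`. -/
noncomputable def current (a b : ℝ → ℝ → ℝ) (Φ : E → E) (u : ℝ → ℝ → E) (t x : ℝ) : E :=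
  a t x • fderiv ℝ Φ (u t x) (deriv (u t) x) + b t x • Φ (u t x)

/-- `u` is a classical solution of `∂ₜu = ∂ₓ(a DΦ(u) ∂ₓu + b Φ(u))` on `[0,T] × ℝ` that is bounded
together with `∂ₜu` and `∂ₓu`; the time derivative is one-sided at the end points. -/
structure IsBoundedSolution (T : ℝ) (a b : ℝ → ℝ → ℝ) (Φ : E → E) (u : ℝ → ℝ → E) : Prop where
  diff_t : ∀ t ∈ Icc 0 T, ∀ x, DifferentiableWithinAt ℝ (fun s => u s x) (Icc 0 T) t
  diff_x : ∀ t ∈ Icc 0 T, Differentiable ℝ (u t)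
  hasDerivAt_current : ∀ t ∈ Icc 0 T, ∀ x,
    HasDerivAt (current a b Φ u t) (derivWithin (fun s => u s x) (Icc 0 T) t) x
  exists_bound : ∃ M, ∀ t ∈ Icc 0 T, ∀ x, ‖u t x‖ ≤ M ∧ ‖deriv (u t) x‖ ≤ M ∧
    ‖derivWithin (fun s => u s x) (Icc 0 T) t‖ ≤ M

variable {T : ℝ} {a b : ℝ → ℝ → ℝ} {Φ : E → E} {u : ℝ → ℝ → E}

theorem deriv_clm_comp (ℓ : E →L[ℝ] F) {φ : ℝ → E} {x : ℝ}
    (hφ : DifferentiableAt ℝ φ x) :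
    deriv (fun y => ℓ (φ y)) x = ℓ (deriv φ x) :=
  (ℓ.hasFDerivAt.comp_hasDerivAt x hφ.hasDerivAt).deriv

theorem derivWithin_clm_comp (ℓ : E →L[ℝ] F) {φ : ℝ → E} {s : Set ℝ} {t : ℝ}
    (hφ : DifferentiableWithinAt ℝ φ s t) :
    derivWithin (fun r => ℓ (φ r)) s t = ℓ (derivWithin φ s t) := by
  by_cases hs : UniqueDiffWithinAt ℝ s t
  · exact (ℓ.hasFDerivAt.comp_hasDerivWithinAt t hφ.hasDerivWithinAt).derivWithin hs
  · simp only [derivWithin_zero_of_not_uniqueDiffWithinAt hs, map_zero]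

/-- A linear functional conserved by the nonlinearity, such as the total density, solves a linear
equation. -/
theorem IsBoundedSolution.map (hu : IsBoundedSolution T a b Φ u) (ℓ : E →L[ℝ] F)
    (hΦ : ∀ t ∈ Icc 0 T, ∀ x, DifferentiableAt ℝ Φ (u t x))
    (hℓ : ∀ t ∈ Icc 0 T, ∀ x, ℓ ∘ Φ =ᶠ[𝓝 (u t x)] ℓ) :
    IsBoundedSolution T a b id fun t x => ℓ (u t x) := by
  have hspace : ∀ t ∈ Icc 0 T, ∀ x, HasDerivAt (fun y => ℓ (u t y)) (ℓ (deriv (u t) x)) x :=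
    fun t ht x => ℓ.hasFDerivAt.comp_hasDerivAt x (hu.diff_x t ht x).hasDerivAt
  have htime : ∀ t ∈ Icc 0 T, ∀ x, derivWithin (fun s => ℓ (u s x)) (Icc 0 T) t
      = ℓ (derivWithin (fun s => u s x) (Icc 0 T) t) := fun t ht x =>
    derivWithin_clm_comp ℓ (hu.diff_t t ht x)
  have hcurrent : ∀ t ∈ Icc 0 T, current a b id (fun t x => ℓ (u t x)) t
      = fun x => ℓ (current a b Φ u t x) := fun t ht => by
    ext x
    have hderiv : ℓ.comp (fderiv ℝ Φ (u t x)) = ℓ := by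
      rw [← ((ℓ.hasFDerivAt.comp _ (hΦ t ht x).hasFDerivAt)).fderiv, (hℓ t ht x).fderiv_eq,
        ℓ.fderiv]
    have hvalue : ℓ (Φ (u t x)) = ℓ (u t x) := (hℓ t ht x).eq_of_nhds
    simp only [current, map_add, map_smul, hvalue, (hspace t ht x).deriv, fderiv_id,
      ContinuousLinearMap.id_apply, id, ← ContinuousLinearMap.comp_apply ℓ, hderiv]
  obtain ⟨M, hM⟩ := hu.exists_bound
  refine ⟨fun t ht x => ℓ.differentiableAt.comp_differentiableWithinAt t (hu.diff_t t ht x),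
    fun t ht x => (hspace t ht x).differentiableAt, fun t ht x => ?_, ‖ℓ‖ * M, fun t ht x => ?_⟩
  · rw [hcurrent t ht, htime t ht x]
    exact ℓ.hasFDerivAt.comp_hasDerivAt x (hu.hasDerivAt_current t ht x)
  · rw [(hspace t ht x).deriv, htime t ht x]
    obtain ⟨h₀, h₁, h₂⟩ := hM t ht x
    exact ⟨ℓ.le_opNorm_of_le h₀, ℓ.le_opNorm_of_le h₁, ℓ.le_opNorm_of_le h₂⟩

theorem norm_smul_apply_add_le {a a₁ L R : ℝ} (ha : |a| ≤ a₁) {A : E →L[ℝ] E} (hA : ‖A‖ ≤ L)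
    {w ξ r : E} (hR : 0 ≤ R) (hr : ‖r‖ ≤ R * ‖w‖) :
    ‖a • A ξ + r‖ ≤ (a₁ * L + R) * (‖w‖ + ‖ξ‖) := by
  have hL : 0 ≤ a₁ * L := mul_nonneg ((abs_nonneg a).trans ha) ((norm_nonneg A).trans hA)
  have hmain : ‖a • A ξ‖ ≤ a₁ * L * ‖ξ‖ := by
    rw [norm_smul, mul_assoc]
    exact mul_le_mul ha (A.le_of_opNorm_le hA ξ) (norm_nonneg _) ((abs_nonneg a).trans ha)
  linarith [norm_add_le (a • A ξ) r, mul_nonneg hL (norm_nonneg w), mul_nonneg hR (norm_nonneg ξ)]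

theorem exists_current_sub_eq {v : ℝ → ℝ → E} {a₁ b₁ M : ℝ} {L : NNReal} {K : Set E}
    (hΦ : LipschitzOnWith L Φ K) (hΦ' : LipschitzOnWith L (fderiv ℝ Φ) K) {t x : ℝ}
    (ha : |a t x| ≤ a₁) (hb : |b t x| ≤ b₁) (hu : u t x ∈ K) (hv : v t x ∈ K)
    (hM : ‖deriv (v t) x‖ ≤ M) :
    ∃ r, current a b Φ u t x - current a b Φ v t x
        = a t x • fderiv ℝ Φ (u t x) (deriv (u t) x - deriv (v t) x) + r ∧
      ‖r‖ ≤ (a₁ * L * M + b₁ * L) * ‖u t x - v t x‖ := by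
  refine ⟨a t x • (fderiv ℝ Φ (u t x) - fderiv ℝ Φ (v t x)) (deriv (v t) x)
    + b t x • (Φ (u t x) - Φ (v t x)), ?_, (norm_add_le _ _).trans ?_⟩
  · simp only [current, map_sub, smul_sub, sub_apply]
    abel
  have ha₁ : 0 ≤ a₁ := (abs_nonneg _).trans ha
  rw [norm_smul, norm_smul, add_mul]
  refine add_le_add ?_ ?_
  · calc ‖a t x‖ * ‖(fderiv ℝ Φ (u t x) - fderiv ℝ Φ (v t x)) (deriv (v t) x)‖
        ≤ a₁ * (L * ‖u t x - v t x‖ * M) := mul_le_mul ha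
          (ContinuousLinearMap.le_of_opNorm_le_of_le _ (hΦ'.norm_sub_le hu hv) hM)
          (norm_nonneg _) ha₁
      _ = a₁ * L * M * ‖u t x - v t x‖ := by ring
  · rw [mul_assoc]
    exact mul_le_mul hb (hΦ.norm_sub_le hu hv) (norm_nonneg _) ((abs_nonneg _).trans hb)

end Equation

variable {E : Type*} [NormedAddCommGroup E] [InnerProductSpace ℝ E] {T : ℝ} {a b : ℝ → ℝ → ℝ}
  {Φ : E → E} {u v : ℝ → ℝ → E}

theorem le_inner_smul_apply_add {a a₀ c R : ℝ} (ha₀ : 0 ≤ a₀) (ha : a₀ ≤ a) {A : E →L[ℝ] E}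
    {w ξ r : E} (hA : c * ‖ξ‖ ^ 2 ≤ ⟪ξ, A ξ⟫) (hA₀ : 0 ≤ c) (hr : ‖r‖ ≤ R * ‖w‖) :
    a₀ * c * ‖ξ‖ ^ 2 - R * ‖w‖ * ‖ξ‖ ≤ ⟪ξ, a • A ξ + r⟫ := by
  have hmain : a₀ * (c * ‖ξ‖ ^ 2) ≤ a * ⟪ξ, A ξ⟫ :=
    mul_le_mul ha hA (by positivity) (ha₀.trans ha)
  have hrest := (neg_abs_le _).trans' (neg_le_neg (abs_inner_le_mul (le_refl ‖ξ‖) hr))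
  rw [inner_add_right, real_inner_smul_right]
  linarith

theorem IsBoundedSolution.isDissipative_sub {c C M : ℝ} (hu : IsBoundedSolution T a b Φ u)
    (hv : IsBoundedSolution T a b Φ v)
    (hM : ∀ t ∈ Icc 0 T, ∀ x, ‖u t x - v t x‖ ≤ M ∧ ‖deriv (u t) x - deriv (v t) x‖ ≤ M ∧
      ‖derivWithin (fun s => u s x) (Icc 0 T) t - derivWithin (fun s => v s x) (Icc 0 T) t‖ ≤ M)
    (hC : ∀ t ∈ Icc 0 T, ∀ x, ‖current a b Φ u t x - current a b Φ v t x‖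
      ≤ C * (‖u t x - v t x‖ + ‖deriv (u t) x - deriv (v t) x‖))
    (hc : ∀ t ∈ Icc 0 T, ∀ x, c * ‖deriv (u t) x - deriv (v t) x‖ ^ 2
        - C * ‖u t x - v t x‖ * ‖deriv (u t) x - deriv (v t) x‖
      ≤ ⟪deriv (u t) x - deriv (v t) x, current a b Φ u t x - current a b Φ v t x⟫) :
    IsDissipative T c C M (fun t x => u t x - v t x)
      (fun t x => derivWithin (fun s => u s x) (Icc 0 T) t
        - derivWithin (fun s => v s x) (Icc 0 T) t)
      (fun t x => deriv (u t) x - deriv (v t) x)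
      (fun t x => current a b Φ u t x - current a b Φ v t x) where
  continuousOn_time x t ht :=
    (hu.diff_t t ht x).continuousWithinAt.sub (hv.diff_t t ht x).continuousWithinAt
  hasDerivAt_time t ht x := by
    have ht' := Ioo_subset_Icc_self ht
    have hnhds := Icc_mem_nhds ht.1 ht.2
    exact ((hu.diff_t t ht' x).hasDerivWithinAt.hasDerivAt hnhds).sub
      ((hv.diff_t t ht' x).hasDerivWithinAt.hasDerivAt hnhds)
  hasDerivAt_space t ht x := (hu.diff_x t ht x).hasDerivAt.sub (hv.diff_x t ht x).hasDerivAt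
  hasDerivAt_current t ht x := (hu.hasDerivAt_current t ht x).sub (hv.hasDerivAt_current t ht x)
  norm_le t ht x := (hM t ht x).1
  norm_time_le t ht x := (hM t ht x).2.2
  norm_space_le t ht x := (hM t ht x).2.1
  norm_current_le := hC
  coercive := hc

theorem IsBoundedSolution.eq_of_coercive [CompleteSpace E] {c a₀ a₁ b₁ : ℝ} {K : Set E}
    (hu : IsBoundedSolution T a b Φ u) (hv : IsBoundedSolution T a b Φ v) (hK : IsCompact K)
    (hΦ : ∀ z ∈ K, ContDiffAt ℝ 2 Φ z) (huK : ∀ t ∈ Icc 0 T, ∀ x, u t x ∈ K)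
    (hvK : ∀ t ∈ Icc 0 T, ∀ x, v t x ∈ K) (ha₀ : 0 < a₀)
    (ha : ∀ t ∈ Icc 0 T, ∀ x, a t x ∈ Icc a₀ a₁) (hb : ∀ t ∈ Icc 0 T, ∀ x, |b t x| ≤ b₁)
    (hc : 0 < c) (hcoer : ∀ t ∈ Icc 0 T, ∀ x, c * ‖deriv (u t) x - deriv (v t) x‖ ^ 2
      ≤ ⟪deriv (u t) x - deriv (v t) x, fderiv ℝ Φ (u t x) (deriv (u t) x - deriv (v t) x)⟫)
    (h₀ : u 0 = v 0) {t : ℝ} (ht : t ∈ Icc 0 T) : u t = v t := by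
  obtain ⟨L, hL, hL', hLbdd⟩ := exists_lipschitzOnWith_fderiv hK hΦ
  obtain ⟨M₁, hM₁⟩ := hu.exists_bound
  obtain ⟨M₂, hM₂⟩ := hv.exists_bound
  set R := a₁ * L * M₂ + b₁ * L
  have haabs : ∀ t ∈ Icc 0 T, ∀ x, |a t x| ≤ a₁ := fun t ht x =>
    (abs_of_nonneg (ha₀.le.trans (ha t ht x).1)).trans_le (ha t ht x).2
  have hdiff := fun t ht x =>
    exists_current_sub_eq hL hL' (haabs t ht x) (hb t ht x) (huK t ht x) (hvK t ht x)
      (hM₂ t ht x).2.1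
  have ha₁ : 0 ≤ a₁ := (abs_nonneg _).trans (haabs t ht 0)
  have hR₀ : 0 ≤ R := add_nonneg
    (mul_nonneg (mul_nonneg ha₁ L.2) ((norm_nonneg _).trans (hM₂ t ht 0).1))
    (mul_nonneg ((abs_nonneg _).trans (hb t ht 0)) L.2)
  have hdiss := hu.isDissipative_sub (c := a₀ * c) (C := a₁ * L + R) (M := M₁ + M₂) hv
    (fun t ht x => ⟨norm_sub_le_of_le (hM₁ t ht x).1 (hM₂ t ht x).1,
      norm_sub_le_of_le (hM₁ t ht x).2.1 (hM₂ t ht x).2.1,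
      norm_sub_le_of_le (hM₁ t ht x).2.2 (hM₂ t ht x).2.2⟩)
    (fun t ht x => by
      obtain ⟨r, hr, hrle⟩ := hdiff t ht x
      rw [hr]
      exact norm_smul_apply_add_le (haabs t ht x) (hLbdd _ (huK t ht x)) hR₀ hrle)
    (fun t ht x => by
      obtain ⟨r, hr, hrle⟩ := hdiff t ht x
      rw [hr]
      refine le_inner_smul_apply_add ha₀.le (ha t ht x).1 (hcoer t ht x) hc.le (hrle.trans ?_)
      exact mul_le_mul_of_nonneg_right (le_add_of_nonneg_left (mul_nonneg ha₁ L.2))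
        (norm_nonneg _))
  ext1 x
  exact sub_eq_zero.1 (hdiss.eq_zero (mul_pos ha₀ hc) (fun x => by simp [h₀]) ht x)

theorem IsBoundedSolution.eq_of_linear [ProperSpace E] {a₀ a₁ b₁ : ℝ}
    (hu : IsBoundedSolution T a b id u) (hv : IsBoundedSolution T a b id v) (ha₀ : 0 < a₀)
    (ha : ∀ t ∈ Icc 0 T, ∀ x, a t x ∈ Icc a₀ a₁) (hb : ∀ t ∈ Icc 0 T, ∀ x, |b t x| ≤ b₁)
    (h₀ : u 0 = v 0) {t : ℝ} (ht : t ∈ Icc 0 T) : u t = v t := by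
  obtain ⟨M₁, hM₁⟩ := hu.exists_bound
  obtain ⟨M₂, hM₂⟩ := hv.exists_bound
  refine hu.eq_of_coercive hv (isCompact_closedBall 0 (max M₁ M₂)) (fun z _ => contDiffAt_id)
    (fun t ht x => ?_) (fun t ht x => ?_) ha₀ ha hb one_pos (fun _ _ _ => ?_) h₀ ht
  · exact mem_closedBall_zero_iff.2 ((hM₁ t ht x).1.trans (le_max_left _ _))
  · exact mem_closedBall_zero_iff.2 ((hM₂ t ht x).1.trans (le_max_right _ _))
  · rw [fderiv_id, ContinuousLinearMap.id_apply, real_inner_self_eq_norm_sq, one_mul]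

end Quasilinear

section QuadraticForm

variable {ι : Type*} {f : ι → ℝ}

theorem sq_sum_le_sum_div_mul (s : Finset ι) (hf : ∀ i, 0 < f i) (a ξ : ι → ℝ) :
    (∑ i ∈ s, a i * ξ i) ^ 2 ≤ (∑ i ∈ s, a i ^ 2 / f i) * ∑ i ∈ s, f i * ξ i ^ 2 :=
  Finset.sum_sq_le_sum_mul_sum_of_sq_le_mul s (fun i _ => div_nonneg (sq_nonneg _) (hf i).le)
    (fun i _ => mul_nonneg (hf i).le (sq_nonneg _)) fun i _ => by
      rw [mul_pow, div_mul_eq_mul_div, mul_left_comm, mul_div_cancel_left₀ _ (hf i).ne']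

theorem sum_sub_sq_div (s : Finset ι) (hf : ∀ i, 0 < f i) (l : ℝ) :
    ∑ i ∈ s, (l - f i) ^ 2 / f i
      = l ^ 2 * ∑ i ∈ s, 1 / f i - 2 * l * s.card + ∑ i ∈ s, f i := by
  rw [Finset.cast_card, Finset.mul_sum, Finset.mul_sum, ← Finset.sum_sub_distrib,
    ← Finset.sum_add_distrib]
  refine Finset.sum_congr rfl fun i _ => ?_
  have := (hf i).ne'
  field_simp
  ring

/-- The constant is the least eigenvalue of the symmetrized form `(∑ ξᵢ) (∑ fᵢ ξᵢ)` relative to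
`∑ fᵢ ξᵢ²`. The proof is `sq_sum_le_sum_div_mul` with `a = l - f`, for the optimal
`l = √(∑ fᵢ / ∑ fᵢ⁻¹)`. -/
theorem half_card_sub_sqrt_mul_le (s : Finset ι) (hf : ∀ i, 0 < f i) (ξ : ι → ℝ) :
    1 / 2 * (s.card - √((∑ i ∈ s, f i) * ∑ i ∈ s, 1 / f i)) * ∑ i ∈ s, f i * ξ i ^ 2
      ≤ (∑ i ∈ s, ξ i) * ∑ i ∈ s, f i * ξ i := by
  obtain rfl | hs := s.eq_empty_or_nonempty
  · simp
  set a := ∑ i ∈ s, f i with ha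
  set b := ∑ i ∈ s, 1 / f i with hb
  have ha₀ : 0 < a := Finset.sum_pos (fun i _ => hf i) hs
  have hb₀ : 0 < b := Finset.sum_pos (fun i _ => one_div_pos.2 (hf i)) hs
  set l := √(a / b)
  have hl₀ : 0 < l := Real.sqrt_pos.2 (div_pos ha₀ hb₀)
  have hla : l ^ 2 * b = a := by
    rw [Real.sq_sqrt (div_pos ha₀ hb₀).le, div_mul_cancel₀ _ hb₀.ne']
  have hlb : √(a * b) = l * b := by
    rw [← hla, show l ^ 2 * b * b = (l * b) ^ 2 by ring, Real.sqrt_sq (by positivity)]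
  have hcauchy := sq_sum_le_sum_div_mul s hf (fun i => l - f i) ξ
  simp only [sub_mul, Finset.sum_sub_distrib, ← Finset.mul_sum] at hcauchy
  rw [sum_sub_sq_div s hf, ← ha, ← hb, hla] at hcauchy
  rw [hlb]
  set X := ∑ i ∈ s, ξ i
  set Y := ∑ i ∈ s, f i * ξ i
  set Z := ∑ i ∈ s, f i * ξ i ^ 2
  have hmul : l * (1 / 2 * (s.card - l * b) * Z) ≤ l * (X * Y) := by
    have hexpand : (a - 2 * l * s.card + a) * Z = 2 * (l ^ 2 * b - l * s.card) * Z := by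
      rw [hla]; ring
    nlinarith [sq_nonneg (l * X + Y)]
  exact le_of_mul_le_mul_left hmul hl₀

variable [Fintype ι]

theorem mul_sum_le_sum_mul_sq [DecidableEq ι] (hf : ∀ i, 0 < f i) {ξ : ι → ℝ}
    (hξ : ∑ i, ξ i = 0) (k : ι)
    (hk : √((∑ i ∈ Finset.univ.erase k, f i) * ∑ i ∈ Finset.univ.erase k, 1 / f i)
      ≤ Fintype.card ι + 1) :
    ξ k * ∑ i, f i * ξ i ≤ ∑ i, f i * ξ i ^ 2 := by
  have hcard : ((Finset.univ.erase k).card : ℝ) = Fintype.card ι - 1 := by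
    rw [Finset.card_erase_of_mem (Finset.mem_univ k), Finset.card_univ,
      Nat.cast_pred (Fintype.card_pos_iff.2 ⟨k⟩)]
  have hform := half_card_sub_sqrt_mul_le (Finset.univ.erase k) hf ξ
  have hsum := Finset.add_sum_erase Finset.univ ξ (Finset.mem_univ k)
  have hZ : 0 ≤ ∑ i ∈ Finset.univ.erase k, f i * ξ i ^ 2 :=
    Finset.sum_nonneg fun i _ => mul_nonneg (hf i).le (sq_nonneg _)
  rw [hcard, show ∑ i ∈ Finset.univ.erase k, ξ i = -ξ k by linarith] at hform
  rw [← Finset.add_sum_erase Finset.univ (fun i => f i * ξ i) (Finset.mem_univ k),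
    ← Finset.add_sum_erase Finset.univ (fun i => f i * ξ i ^ 2) (Finset.mem_univ k)]
  nlinarith [mul_nonneg (sub_nonneg.2 hk) hZ]

theorem sum_mul_sum_le_of_forall_mul_le {u ξ : ι → ℝ} {Y Z : ℝ} (hu : ∀ i, 0 ≤ u i)
    (h : ∀ i, ξ i * Y ≤ Z) : (∑ i, u i * ξ i) * Y ≤ (∑ i, u i) * Z := by
  rw [Finset.sum_mul, Finset.sum_mul]
  refine Finset.sum_le_sum fun i _ => ?_
  rw [mul_assoc]
  exact mul_le_mul_of_nonneg_left (h i) (hu i)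

theorem abs_sum_mul_le_of_sum_eq_zero (f : ι → ℝ) {ξ : ι → ℝ} (hξ : ∑ i, ξ i = 0) (μ : ℝ) :
    |∑ i, f i * ξ i| ≤ √(∑ i, (f i - μ) ^ 2) * √(∑ i, ξ i ^ 2) := by
  have hcenter : ∑ i, f i * ξ i = ∑ i, (f i - μ) * ξ i := by
    simp only [sub_mul, Finset.sum_sub_distrib, ← Finset.mul_sum, hξ, mul_zero, sub_zero]
  rw [hcenter, ← Real.sqrt_mul (Finset.sum_nonneg fun _ _ => sq_nonneg _)]
  exact Real.abs_le_sqrt (Finset.sum_mul_sq_le_sq_mul_sq _ _ _)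

theorem abs_sum_mul_le_sum_mul_sqrt {u : ι → ℝ} (hu : ∀ i, 0 ≤ u i) (ξ : ι → ℝ) :
    |∑ i, u i * ξ i| ≤ (∑ i, u i) * √(∑ i, ξ i ^ 2) := by
  rw [Finset.sum_mul]
  refine (Finset.abs_sum_le_sum_abs _ _).trans (Finset.sum_le_sum fun i _ => ?_)
  rw [abs_mul, abs_of_nonneg (hu i)]
  exact mul_le_mul_of_nonneg_left (Real.abs_le_sqrt (Finset.single_le_sum
    (f := fun j => ξ j ^ 2) (fun _ _ => sq_nonneg _) (Finset.mem_univ i))) (hu i)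

theorem sum_mul_sum_le_sum_mul_sum_sq {u ξ : ι → ℝ} {m μ : ℝ} (hm : ∀ i, m ≤ f i)
    (hμ : √(∑ i, (f i - μ) ^ 2) ≤ m) (hu : ∀ i, 0 ≤ u i) (hξ : ∑ i, ξ i = 0) :
    (∑ i, u i * ξ i) * ∑ i, f i * ξ i ≤ (∑ i, f i * u i) * ∑ i, ξ i ^ 2 := by
  have hR : 0 ≤ ∑ i, ξ i ^ 2 := Finset.sum_nonneg fun _ _ => sq_nonneg _
  have hY : |∑ i, f i * ξ i| ≤ m * √(∑ i, ξ i ^ 2) :=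
    (abs_sum_mul_le_of_sum_eq_zero f hξ μ).trans
      (mul_le_mul_of_nonneg_right hμ (Real.sqrt_nonneg _))
  calc (∑ i, u i * ξ i) * ∑ i, f i * ξ i
      ≤ |∑ i, u i * ξ i| * |∑ i, f i * ξ i| := (le_abs_self _).trans_eq (abs_mul _ _)
    _ ≤ ((∑ i, u i) * √(∑ i, ξ i ^ 2)) * (m * √(∑ i, ξ i ^ 2)) :=
        mul_le_mul (abs_sum_mul_le_sum_mul_sqrt hu ξ) hY (abs_nonneg _)
          ((abs_nonneg _).trans (abs_sum_mul_le_sum_mul_sqrt hu ξ))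
    _ = (∑ i, m * u i) * (√(∑ i, ξ i ^ 2) * √(∑ i, ξ i ^ 2)) := by
        rw [← Finset.mul_sum]; ring
    _ ≤ (∑ i, f i * u i) * ∑ i, ξ i ^ 2 := by
        rw [Real.mul_self_sqrt hR]
        exact mul_le_mul_of_nonneg_right
          (Finset.sum_le_sum fun i _ => mul_le_mul_of_nonneg_right (hm i) (hu i)) hR

end QuadraticForm

section SmallRange

variable {N : ℕ} {f : Fin N → ℝ}

theorem fmin_le (f : Fin N → ℝ) (n : Fin N) : fmin f ≤ f n :=
  ciInf_le (Set.finite_range f).bddBelow n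

theorem le_fmax (f : Fin N → ℝ) (n : Fin N) : f n ≤ fmax f :=
  le_ciSup (Set.finite_range f).bddAbove n

theorem fmin_pos [NeZero N] (hf : ∀ n, 0 < f n) : 0 < fmin f := by
  obtain ⟨n, hn⟩ := exists_eq_ciInf_of_finite (f := f)
  rw [fmin, ← hn]
  exact hf n

theorem SmallRange.sqrt_sum_erase_le [NeZero N] (h : SmallRange f) (hf : ∀ n, 0 < f n)
    (k : Fin N) :
    √((∑ n ∈ Finset.univ.erase k, f n) * ∑ n ∈ Finset.univ.erase k, 1 / f n) ≤ N + 1 := by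
  have hmin := fmin_pos hf
  have hrange : 0 ≤ fmax f - fmin f := sub_nonneg.2 ((fmin_le f 0).trans (le_fmax f 0))
  have hnonneg : 0 ≤ 1 / fmin f * √(∑ n, (f n - fbar f) ^ 2) + (fmax f - fmin f) / fmin f := by
    positivity
  have hsup := le_ciSup (Set.finite_range fun k : Fin N =>
    √((∑ n ∈ Finset.univ.erase k, f n) * ∑ n ∈ Finset.univ.erase k, 1 / f n)).bddAbove k
  linarith [h.trans_le (min_le_left _ _)]

theorem SmallRange.sqrt_sum_sub_fbar_sq_le [NeZero N] (h : SmallRange f) (hf : ∀ n, 0 < f n) :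
    √(∑ n, (f n - fbar f) ^ 2) ≤ fmin f := by
  have hmin := fmin_pos hf
  have hrange : 0 ≤ (fmax f - fmin f) / fmin f :=
    div_nonneg (sub_nonneg.2 ((fmin_le f 0).trans (le_fmax f 0))) hmin.le
  have hle : 1 / fmin f * √(∑ n, (f n - fbar f) ^ 2) ≤ 1 := by
    linarith [h.trans_le (min_le_right _ _)]
  rwa [one_div, inv_mul_le_iff₀ hmin, mul_one] at hle

end SmallRange

section Nonlinearity

variable {N : ℕ} {ε : ℝ} {f : Fin N → ℝ}

/-- The nonlinearity `u ↦ (B^ε_n(u) u_n)_n` of the system, on Euclidean space. -/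
noncomputable def nonlin (ε : ℝ) (f : Fin N → ℝ) (z : EuclideanSpace ℝ (Fin N)) :
    EuclideanSpace ℝ (Fin N) :=
  WithLp.toLp 2 fun n => B ε f z.ofLp n * z n

/-- The sum of the coordinates as a functional on Euclidean space. -/
noncomputable def sumCLM (N : ℕ) : EuclideanSpace ℝ (Fin N) →L[ℝ] ℝ :=
  ∑ n, EuclideanSpace.proj n

theorem sumCLM_apply (z : EuclideanSpace ℝ (Fin N)) : sumCLM N z = ∑ n, z n := by
  simp [sumCLM]

/-- The part of the ball of radius `M` in the nonnegative orthant. -/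
def orthantBall (N : ℕ) (M : ℝ) : Set (EuclideanSpace ℝ (Fin N)) :=
  Metric.closedBall 0 M ∩ {z | ∀ n, 0 ≤ z n}

theorem isCompact_orthantBall (N : ℕ) (M : ℝ) : IsCompact (orthantBall N M) := by
  refine (isCompact_closedBall 0 M).inter_right ?_
  rw [ofPred_forall]
  exact isClosed_iInter fun n => isClosed_le continuous_const (by fun_prop)

theorem denom_pos (hε : 0 < ε) (hf : ∀ n, 0 < f n) {z : Fin N → ℝ} (hz : ∀ n, 0 ≤ z n) :
    0 < ε + ∑ k, f k * z k :=
  add_pos_of_pos_of_nonneg hε (Finset.sum_nonneg fun k _ => mul_nonneg (hf k).le (hz k))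

theorem contDiffAt_nonlin {z : EuclideanSpace ℝ (Fin N)} (hz : ε + ∑ k, f k * z k ≠ 0) :
    ContDiffAt ℝ 2 (nonlin ε f) z := by
  refine contDiffAt_euclidean.2 fun n => ?_
  have hcoord : ∀ k, ContDiffAt ℝ 2 (fun y : EuclideanSpace ℝ (Fin N) => y k) z := by fun_prop
  exact ContDiffAt.mul (ContDiffAt.fun_div (by fun_prop) (by fun_prop) hz) (hcoord n)

theorem sumCLM_nonlin {z : EuclideanSpace ℝ (Fin N)} (hz : ε + ∑ k, f k * z k ≠ 0) :
    sumCLM N (nonlin ε f z) = sumCLM N z := by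
  have hcoord : ∀ n, nonlin ε f z n
      = (ε * z n + (∑ k, z k) * (f n * z n)) / (ε + ∑ k, f k * z k) := fun n => by
    simp only [nonlin, B]
    ring
  simp only [sumCLM_apply, hcoord]
  rw [← Finset.sum_div, Finset.sum_add_distrib, ← Finset.mul_sum, ← Finset.mul_sum,
    div_eq_iff hz]
  ring

theorem sumCLM_comp_nonlin_eventuallyEq {z : EuclideanSpace ℝ (Fin N)}
    (hz : ε + ∑ k, f k * z k ≠ 0) : sumCLM N ∘ nonlin ε f =ᶠ[𝓝 z] sumCLM N := by
  have hcont : ContinuousAt (fun y : EuclideanSpace ℝ (Fin N) => ε + ∑ k, f k * y k) z := by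
    fun_prop
  filter_upwards [hcont.eventually_ne hz] with y hy using sumCLM_nonlin hy

theorem fderiv_nonlin_apply {z ξ : EuclideanSpace ℝ (Fin N)} (hz : ε + ∑ k, f k * z k ≠ 0)
    (hξ : ∑ k, ξ k = 0) (n : Fin N) :
    fderiv ℝ (nonlin ε f) z ξ n
      = B ε f z.ofLp n * (ξ n - (∑ k, f k * ξ k) / (ε + ∑ k, f k * z k) * z n) := by
  have hline := (EuclideanSpace.proj (𝕜 := ℝ) n).hasFDerivAt.comp_hasDerivAt 0
    (((contDiffAt_nonlin hz).differentiableAt two_ne_zero).hasFDerivAt.hasLineDerivAt ξ)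
  have hvalue : ∀ s : ℝ, nonlin ε f (z + s • ξ) n = (ε + f n * ∑ k, z k)
      / (ε + ∑ k, f k * z k + s * ∑ k, f k * ξ k) * (z n + s * ξ n) := fun s => by
    simp only [nonlin, B, PiLp.add_apply, PiLp.smul_apply, smul_eq_mul, Finset.sum_add_distrib,
      ← Finset.mul_sum, hξ, mul_add, mul_left_comm (f _) s, mul_zero, add_zero, add_assoc]
  have hdenom : HasDerivAt (fun s : ℝ => ε + ∑ k, f k * z k + s * ∑ k, f k * ξ k)
      (∑ k, f k * ξ k) 0 := by
    simpa using ((hasDerivAt_id (0 : ℝ)).mul_const (∑ k, f k * ξ k)).const_add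
      (ε + ∑ k, f k * z k)
  have hfactor : HasDerivAt (fun s : ℝ => z n + s * ξ n) (ξ n) 0 := by
    simpa using ((hasDerivAt_id (0 : ℝ)).mul_const (ξ n)).const_add (z n)
  have hderiv := ((hasDerivAt_const (0 : ℝ) (ε + f n * ∑ k, z k)).fun_div hdenom
    (by simpa using hz)).fun_mul hfactor
  refine (hline.unique (hderiv.congr_of_eventuallyEq (.of_forall hvalue))).trans ?_
  simp only [B, zero_mul, add_zero, zero_sub]
  field_simp
  ring

theorem inner_fderiv_nonlin {z ξ : EuclideanSpace ℝ (Fin N)} (hz : ε + ∑ k, f k * z k ≠ 0)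
    (hξ : ∑ k, ξ k = 0) :
    ⟪ξ, fderiv ℝ (nonlin ε f) z ξ⟫
      = ((ε + ∑ k, f k * z k) * (ε * ∑ n, ξ n ^ 2 + (∑ k, z k) * ∑ n, f n * ξ n ^ 2)
          - (ε * ∑ n, z n * ξ n + (∑ k, z k) * ∑ n, f n * z n * ξ n) * ∑ k, f k * ξ k)
        / (ε + ∑ k, f k * z k) ^ 2 := by
  have hterm : ∀ n, ⟪ξ n, fderiv ℝ (nonlin ε f) z ξ n⟫
      = (ε * ξ n ^ 2 + (∑ k, z k) * (f n * ξ n ^ 2)) / (ε + ∑ k, f k * z k)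
        - (ε * (z n * ξ n) + (∑ k, z k) * (f n * z n * ξ n))
          * ((∑ k, f k * ξ k) / (ε + ∑ k, f k * z k) ^ 2) := fun n => by
    simp only [RCLike.inner_apply, conj_trivial, fderiv_nonlin_apply hz hξ, B]
    field_simp
  rw [PiLp.inner_apply, Finset.sum_congr rfl fun n _ => hterm n, Finset.sum_sub_distrib,
    ← Finset.sum_div, ← Finset.sum_mul]
  simp only [Finset.sum_add_distrib, ← Finset.mul_sum]
  field_simp

theorem le_inner_fderiv_nonlin (hε : 0 < ε) (hf : ∀ n, 0 < f n)
    (hvertex : ∀ k, √((∑ n ∈ Finset.univ.erase k, f n) * ∑ n ∈ Finset.univ.erase k, 1 / f n)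
      ≤ N + 1)
    (hvariance : √(∑ n, (f n - fbar f) ^ 2) ≤ fmin f) {z ξ : EuclideanSpace ℝ (Fin N)}
    (hz : ∀ n, 0 ≤ z n) (hξ : ∑ k, ξ k = 0) :
    ε ^ 2 / (ε + ∑ k, f k * z k) ^ 2 * ‖ξ‖ ^ 2 ≤ ⟪ξ, fderiv ℝ (nonlin ε f) z ξ⟫ := by
  have hD := denom_pos hε hf hz
  have hs : 0 ≤ ∑ k, z k := Finset.sum_nonneg fun k _ => hz k
  have hZ : 0 ≤ ∑ n, f n * ξ n ^ 2 :=
    Finset.sum_nonneg fun n _ => mul_nonneg (hf n).le (sq_nonneg _)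
  have hvertices : (∑ n, f n * z n * ξ n) * ∑ k, f k * ξ k
      ≤ (∑ k, f k * z k) * ∑ n, f n * ξ n ^ 2 :=
    sum_mul_sum_le_of_forall_mul_le (fun n => mul_nonneg (hf n).le (hz n)) fun k =>
      mul_sum_le_sum_mul_sq hf hξ k (by simpa using hvertex k)
  have hlinear := sum_mul_sum_le_sum_mul_sum_sq (fmin_le f) hvariance hz hξ
  rw [inner_fderiv_nonlin hD.ne' hξ, EuclideanSpace.real_norm_sq_eq, div_mul_eq_mul_div]
  refine div_le_div_of_nonneg_right ?_ (sq_nonneg _)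
  linarith [mul_le_mul_of_nonneg_left hvertices hs, mul_le_mul_of_nonneg_left hlinear hε.le,
    mul_nonneg (mul_nonneg hε.le hs) hZ]

theorem apply_le_of_mem_orthantBall {M : ℝ} {z : EuclideanSpace ℝ (Fin N)}
    (hz : z ∈ orthantBall N M) (n : Fin N) : z n ≤ M :=
  (le_abs_self _).trans ((PiLp.norm_apply_le z n).trans (mem_closedBall_zero_iff.1 hz.1))

theorem exists_pos_le_inner_fderiv_nonlin (hε : 0 < ε) (hf : ∀ n, 0 < f n)
    (hvertex : ∀ k, √((∑ n ∈ Finset.univ.erase k, f n) * ∑ n ∈ Finset.univ.erase k, 1 / f n)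
      ≤ N + 1)
    (hvariance : √(∑ n, (f n - fbar f) ^ 2) ≤ fmin f) {M : ℝ} (hM : 0 ≤ M) :
    ∃ c > 0, ∀ z ∈ orthantBall N M, ∀ ξ : EuclideanSpace ℝ (Fin N), ∑ k, ξ k = 0 →
      c * ‖ξ‖ ^ 2 ≤ ⟪ξ, fderiv ℝ (nonlin ε f) z ξ⟫ := by
  have hbound := denom_pos hε hf fun _ : Fin N => hM
  refine ⟨ε ^ 2 / (ε + ∑ k, f k * M) ^ 2, by positivity, fun z hz ξ hξ => ?_⟩
  refine le_trans ?_ (le_inner_fderiv_nonlin hε hf hvertex hvariance hz.2 hξ)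
  have hD := denom_pos hε hf hz.2
  gcongr with k
  · exact (hf k).le
  · exact apply_le_of_mem_orthantBall hz k

end Nonlinearity

section Flux

variable {E : Type*} [NormedAddCommGroup E] [NormedSpace ℝ E] {σ : ℝ → ℝ → ℝ} {Φ : E → E}
  {u : ℝ → ℝ → E} {t : ℝ}

/-- The coefficient `a` of the system in the form `∂ₜp = ∂ₓ(a DΦ(p) ∂ₓp + b Φ(p))`. -/
noncomputable def diffusion (σ : ℝ → ℝ → ℝ) (t x : ℝ) : ℝ := σ t x ^ 2 / 2

/-- The coefficient `b` of the system in the form `∂ₜp = ∂ₓ(a DΦ(p) ∂ₓp + b Φ(p))`. -/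
noncomputable def drift (σ : ℝ → ℝ → ℝ) (t x : ℝ) : ℝ := σ t x * dx σ t x + σ t x ^ 2 / 2

theorem hasDerivAt_sq_smul_comp {x : ℝ} (hσ : DifferentiableAt ℝ (σ t) x)
    (hu : DifferentiableAt ℝ (u t) x) (hΦ : DifferentiableAt ℝ Φ (u t x)) :
    HasDerivAt (fun y => σ t y ^ 2 • Φ (u t y))
      (σ t x ^ 2 • fderiv ℝ Φ (u t x) (deriv (u t) x) + (2 * (σ t x * dx σ t x)) • Φ (u t x))
      x := by
  refine ((hσ.hasDerivAt.fun_pow 2).fun_smul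
    (hΦ.hasFDerivAt.comp_hasDerivAt x hu.hasDerivAt)).congr_deriv ?_
  simp only [dx, Function.comp_apply, Nat.cast_ofNat, Nat.add_one_sub_one, pow_one, mul_assoc]

theorem differentiable_deriv_sq_smul_comp (hσ : Differentiable ℝ (σ t))
    (hσ' : Differentiable ℝ (dx σ t)) (hu : Differentiable ℝ (u t))
    (hu' : Differentiable ℝ (deriv (u t))) (hΦ : ∀ x, ContDiffAt ℝ 2 Φ (u t x)) :
    Differentiable ℝ (deriv fun y => σ t y ^ 2 • Φ (u t y)) := by
  have hΦ₁ : ∀ x, DifferentiableAt ℝ Φ (u t x) := fun x => (hΦ x).differentiableAt two_ne_zero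
  have hΦ₂ : ∀ x, DifferentiableAt ℝ (fderiv ℝ Φ) (u t x) := fun x =>
    ((hΦ x).fderiv_right (m := 1) (by norm_num)).differentiableAt one_ne_zero
  rw [funext fun x => (hasDerivAt_sq_smul_comp (hσ x) (hu x) (hΦ₁ x)).deriv]
  exact fun x =>
    (((hσ x).fun_pow 2).fun_smul (((hΦ₂ x).fun_comp' x (hu x)).clm_apply (hu' x))).fun_add
      ((((hσ x).fun_mul (hσ' x)).const_mul 2).fun_smul ((hΦ₁ x).fun_comp' x (hu x)))

theorem hasDerivAt_current_diffusion_drift (hσ : Differentiable ℝ (σ t))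
    (hσ' : Differentiable ℝ (dx σ t)) (hu : Differentiable ℝ (u t))
    (hu' : Differentiable ℝ (deriv (u t))) (hΦ : ∀ x, ContDiffAt ℝ 2 Φ (u t x)) (x : ℝ) :
    HasDerivAt (current (diffusion σ) (drift σ) Φ u t)
      ((1 / 2 : ℝ) • deriv (deriv fun y => σ t y ^ 2 • Φ (u t y)) x
        + (1 / 2 : ℝ) • deriv (fun y => σ t y ^ 2 • Φ (u t y)) x) x := by
  have hflux := fun x =>
    hasDerivAt_sq_smul_comp (hσ x) (hu x) ((hΦ x).differentiableAt two_ne_zero)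
  have hcurrent : current (diffusion σ) (drift σ) Φ u t
      = fun x => (1 / 2 : ℝ) • deriv (fun y => σ t y ^ 2 • Φ (u t y)) x
        + (1 / 2 : ℝ) • (σ t x ^ 2 • Φ (u t x)) := by
    ext x
    rw [(hflux x).deriv]
    simp only [current, diffusion, drift]
    module
  have hderiv := differentiable_deriv_sq_smul_comp hσ hσ' hu hu' hΦ
  rw [hcurrent]
  exact ((hderiv x).hasDerivAt.fun_const_smul _).fun_add
    ((hflux x).differentiableAt.hasDerivAt.fun_const_smul _)

end Flux

section System

variable {N : ℕ} {T ε : ℝ} {f : Fin N → ℝ} {σ : ℝ → ℝ → ℝ} {p q : Fin N → ℝ → ℝ → ℝ}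

/-- `φ` is twice differentiable in space on `[0,T] × ℝ`, and bounded there together with its first
space derivative. -/
structure SpaceRegular (T : ℝ) (φ : ℝ → ℝ → ℝ) : Prop where
  diff_x : ∀ t ∈ Icc 0 T, Differentiable ℝ (φ t)
  diff_xx : ∀ t ∈ Icc 0 T, Differentiable ℝ (dx φ t)
  bdd : BoundedStrip T φ
  bdd_x : BoundedStrip T (dx φ)

/-- The part of parabolic Hölder regularity that the energy method needs. -/
structure ParabolicRegular (T : ℝ) (φ : ℝ → ℝ → ℝ) : Prop extends SpaceRegular T φ where
  diff_t : ∀ t ∈ Icc 0 T, ∀ x, DifferentiableWithinAt ℝ (fun s => φ s x) (Icc 0 T) t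
  bdd_t : BoundedStrip T (dt T φ)

theorem ParabolicHolder.parabolicRegular {β : ℝ} {φ : ℝ → ℝ → ℝ} (h : ParabolicHolder T β φ) :
    ParabolicRegular T φ :=
  ⟨⟨h.diff_x, h.diff_xx, h.bdd, h.bdd_x⟩, h.diff_t, h.bdd_t⟩

/-- `p` is a regular nonnegative classical solution of the system; neither the initial value nor
the masses of its components are prescribed. -/
structure IsNonnegSolution (T ε : ℝ) (f : Fin N → ℝ) (σ : ℝ → ℝ → ℝ) (p : Fin N → ℝ → ℝ → ℝ) :
    Prop where
  regular : ∀ n, ParabolicRegular T (p n)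
  pde : ∀ n, ∀ t ∈ Icc 0 T, ∀ x,
    dt T (p n) t x = 1 / 2 * dx (dx (flux ε f σ p n)) t x + 1 / 2 * dx (flux ε f σ p n) t x
  nonneg : ∀ n, ∀ t ∈ Icc 0 T, ∀ x, 0 ≤ p n t x

theorem IsSolution.isNonnegSolution {m : Fin N → ℝ} {P : Fin N → ℝ → ℝ}
    (h : IsSolution T ε f σ m P p) (hp : ∀ n, ParabolicRegular T (p n)) :
    IsNonnegSolution T ε f σ p :=
  ⟨hp, h.pde, h.nonneg⟩

/-- The family `p` as a single function with values in Euclidean space. -/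
noncomputable def densityVec (p : Fin N → ℝ → ℝ → ℝ) (t x : ℝ) : EuclideanSpace ℝ (Fin N) :=
  WithLp.toLp 2 fun n => p n t x

theorem exists_norm_densityVec_le (hp : ∀ n, BoundedStrip T (p n)) :
    ∃ M, ∀ t ∈ Icc 0 T, ∀ x, ‖densityVec p t x‖ ≤ M := by
  choose C hC using hp
  refine ⟨√(∑ n, C n ^ 2), fun t ht x => ?_⟩
  rw [EuclideanSpace.norm_eq]
  gcongr with n
  exact hC n t ht x

theorem differentiable_densityVec {t : ℝ} (hp : ∀ n, Differentiable ℝ (p n t)) :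
    Differentiable ℝ (densityVec p t) :=
  differentiable_euclidean.2 hp

theorem deriv_densityVec {t : ℝ} (hp : ∀ n, Differentiable ℝ (p n t)) :
    deriv (densityVec p t) = densityVec (fun n => dx (p n)) t := by
  ext x n
  exact (deriv_clm_comp (EuclideanSpace.proj n) (differentiable_densityVec hp x)).symm

theorem derivWithin_densityVec {t x : ℝ}
    (hp : ∀ n, DifferentiableWithinAt ℝ (fun s => p n s x) (Icc 0 T) t) :
    derivWithin (fun s => densityVec p s x) (Icc 0 T) t = densityVec (fun n => dt T (p n)) t x := by
  ext n
  exact (derivWithin_clm_comp (EuclideanSpace.proj n) (differentiableWithinAt_euclidean.2 hp)).symm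

theorem differentiable_deriv_densityVec {t : ℝ} (hp : ∀ n, Differentiable ℝ (p n t))
    (hp' : ∀ n, Differentiable ℝ (dx (p n) t)) : Differentiable ℝ (deriv (densityVec p t)) := by
  rw [deriv_densityVec hp]
  exact differentiable_densityVec hp'

theorem exists_bound_densityVec (hp : ∀ n, ParabolicRegular T (p n)) :
    ∃ M, ∀ t ∈ Icc 0 T, ∀ x, ‖densityVec p t x‖ ≤ M ∧ ‖deriv (densityVec p t) x‖ ≤ M ∧
      ‖derivWithin (fun s => densityVec p s x) (Icc 0 T) t‖ ≤ M := by
  obtain ⟨M₀, h₀⟩ := exists_norm_densityVec_le fun n => (hp n).bdd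
  obtain ⟨M₁, h₁⟩ := exists_norm_densityVec_le fun n => (hp n).bdd_x
  obtain ⟨M₂, h₂⟩ := exists_norm_densityVec_le fun n => (hp n).bdd_t
  refine ⟨max M₀ (max M₁ M₂), fun t ht x => ?_⟩
  rw [deriv_densityVec fun n => (hp n).diff_x t ht,
    derivWithin_densityVec fun n => (hp n).diff_t t ht x]
  simp only [le_max_iff, h₀ t ht x, h₁ t ht x, h₂ t ht x, true_or, or_true, and_self]

theorem IsNonnegSolution.denom_densityVec_pos (hp : IsNonnegSolution T ε f σ p) (hε : 0 < ε)
    (hf : ∀ n, 0 < f n) {t : ℝ} (ht : t ∈ Icc 0 T) (x : ℝ) :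
    0 < ε + ∑ k, f k * densityVec p t x k :=
  denom_pos hε hf fun n => hp.nonneg n t ht x

theorem IsNonnegSolution.derivWithin_densityVec_eq (hp : IsNonnegSolution T ε f σ p) (hε : 0 < ε)
    (hf : ∀ n, 0 < f n) (hσ : SpaceRegular T σ) {t : ℝ} (ht : t ∈ Icc 0 T) (x : ℝ) :
    derivWithin (fun s => densityVec p s x) (Icc 0 T) t
      = (1 / 2 : ℝ) • deriv (deriv fun y => σ t y ^ 2 • nonlin ε f (densityVec p t y)) x
        + (1 / 2 : ℝ) • deriv (fun y => σ t y ^ 2 • nonlin ε f (densityVec p t y)) x := by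
  have hdiff := fun n => (hp.regular n).diff_x t ht
  have hΦ : ∀ x, ContDiffAt ℝ 2 (nonlin ε f) (densityVec p t x) := fun x =>
    contDiffAt_nonlin (hp.denom_densityVec_pos hε hf ht x).ne'
  set F := fun y => σ t y ^ 2 • nonlin ε f (densityVec p t y)
  have hF : Differentiable ℝ F := fun x =>
    (hasDerivAt_sq_smul_comp (hσ.diff_x t ht x) (differentiable_densityVec hdiff x)
      ((hΦ x).differentiableAt two_ne_zero)).differentiableAt
  have hF' : Differentiable ℝ (deriv F) :=
    differentiable_deriv_sq_smul_comp (hσ.diff_x t ht) (hσ.diff_xx t ht)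
      (differentiable_densityVec hdiff)
      (differentiable_deriv_densityVec hdiff fun n => (hp.regular n).diff_xx t ht) hΦ
  ext n
  have hflux : flux ε f σ p n t = fun y => EuclideanSpace.proj (𝕜 := ℝ) n (F y) := by
    ext y
    exact mul_assoc _ _ _
  have hdx : dx (flux ε f σ p n) t = fun y => EuclideanSpace.proj (𝕜 := ℝ) n (deriv F y) := by
    ext y
    rw [dx, hflux, deriv_clm_comp _ (hF y)]
  have hdxx : dx (dx (flux ε f σ p n)) t x = deriv (deriv F) x n := by
    rw [dx, hdx, deriv_clm_comp _ (hF' x)]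
    rfl
  rw [derivWithin_densityVec fun k => (hp.regular k).diff_t t ht x]
  refine (hp.pde n t ht x).trans ?_
  rw [hdxx, hdx]
  rfl

theorem IsNonnegSolution.isBoundedSolution (hp : IsNonnegSolution T ε f σ p) (hε : 0 < ε)
    (hf : ∀ n, 0 < f n) (hσ : SpaceRegular T σ) :
    IsBoundedSolution T (diffusion σ) (drift σ) (nonlin ε f) (densityVec p) where
  diff_t t ht x := differentiableWithinAt_euclidean.2 fun n => (hp.regular n).diff_t t ht x
  diff_x t ht := differentiable_densityVec fun n => (hp.regular n).diff_x t ht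
  hasDerivAt_current t ht x := by
    have hdiff := fun n => (hp.regular n).diff_x t ht
    rw [hp.derivWithin_densityVec_eq hε hf hσ ht x]
    exact hasDerivAt_current_diffusion_drift (hσ.diff_x t ht) (hσ.diff_xx t ht)
      (differentiable_densityVec hdiff)
      (differentiable_deriv_densityVec hdiff fun n => (hp.regular n).diff_xx t ht)
      (fun y => contDiffAt_nonlin (hp.denom_densityVec_pos hε hf ht y).ne') x
  exists_bound := exists_bound_densityVec hp.regular

theorem SpaceRegular.exists_diffusion_mem_Icc (hσ : SpaceRegular T σ) {σ₀ : ℝ} (hσ₀ : 0 < σ₀)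
    (h : ∀ t ∈ Icc 0 T, ∀ x, σ₀ ≤ σ t x) :
    ∃ a₀ > 0, ∃ a₁, ∀ t ∈ Icc 0 T, ∀ x, diffusion σ t x ∈ Icc a₀ a₁ := by
  obtain ⟨C, hC⟩ := hσ.bdd
  refine ⟨σ₀ ^ 2 / 2, by positivity, C ^ 2 / 2, fun t ht x => ⟨?_, ?_⟩⟩
  · exact div_le_div_of_nonneg_right (pow_le_pow_left₀ hσ₀.le (h t ht x) 2) zero_le_two
  · exact div_le_div_of_nonneg_right (sq_le_sq.2 ((hC t ht x).trans (le_abs_self C))) zero_le_two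

theorem SpaceRegular.exists_abs_drift_le (hσ : SpaceRegular T σ) :
    ∃ b₁, ∀ t ∈ Icc 0 T, ∀ x, |drift σ t x| ≤ b₁ := by
  obtain ⟨C, hC⟩ := hσ.bdd
  obtain ⟨D, hD⟩ := hσ.bdd_x
  refine ⟨C * D + C ^ 2 / 2, fun t ht x => ?_⟩
  have hC₀ : 0 ≤ C := (abs_nonneg _).trans (hC t ht x)
  rw [drift]
  refine (abs_add_le _ _).trans (add_le_add ?_ ?_)
  · rw [abs_mul]
    exact mul_le_mul (hC t ht x) (hD t ht x) (abs_nonneg _) hC₀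
  · rw [abs_div, abs_pow, abs_two]
    exact div_le_div_of_nonneg_right (pow_le_pow_left₀ (abs_nonneg _) (hC t ht x) 2) zero_le_two

theorem VolatilityAssumption.contDiff (hσ : VolatilityAssumption σ) {t : ℝ}
    (ht : 0 ≤ t) : ContDiff ℝ ∞ (σ t) :=
  contDiffOn_univ.1 <| hσ.smooth.comp (f := fun x : ℝ => (t, x))
    (by fun_prop : ContDiff ℝ ∞ fun x : ℝ => (t, x)).contDiffOn fun _ _ => ⟨ht, mem_univ _⟩

theorem VolatilityAssumption.exists_abs_dx_le (hσ : VolatilityAssumption σ) :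
    ∃ C, ∀ t, 0 ≤ t → ∀ x, |dx σ t x| ≤ C := by
  obtain ⟨C, hC⟩ := hσ.bdd_deriv 1 le_rfl
  refine ⟨C, fun t ht x => ?_⟩
  set S : Set (ℝ × ℝ) := Ici 0 ×ˢ univ
  have hS : UniqueDiffOn ℝ S := (uniqueDiffOn_Ici 0).prod uniqueDiffOn_univ
  have hmem : (t, x) ∈ S := ⟨ht, mem_univ _⟩
  have hfderiv := ((hσ.smooth (t, x) hmem).differentiableWithinAt (by simp)).hasFDerivWithinAt
  have hline : HasDerivWithinAt (fun y : ℝ => (t, y)) (0, 1) univ x :=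
    ((hasDerivAt_const x t).prodMk (hasDerivAt_id x)).hasDerivWithinAt
  have hderiv : HasDerivAt (σ t) _ x := hasDerivWithinAt_univ.1
    (hfderiv.comp_hasDerivWithinAt x hline fun _ _ => ⟨ht, mem_univ _⟩)
  have hnorm := hC (t, x) hmem
  rw [norm_iteratedFDerivWithin_one _ (hS _ hmem)] at hnorm
  rw [dx, hderiv.deriv, ← Real.norm_eq_abs]
  refine (ContinuousLinearMap.le_opNorm _ _).trans ?_
  simpa [Prod.norm_def] using hnorm

theorem VolatilityAssumption.spaceRegular (hσ : VolatilityAssumption σ) (T : ℝ) :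
    SpaceRegular T σ where
  diff_x t ht := (hσ.contDiff ht.1).differentiable (by simp)
  diff_xx t ht := (contDiff_infty_iff_deriv.1 (hσ.contDiff ht.1)).2.differentiable (by simp)
  bdd := by
    obtain ⟨σ₀, σ₁, hσ₀, -, hbounds⟩ := hσ.bounds
    refine ⟨σ₁, fun t ht x => ?_⟩
    obtain ⟨hlower, hupper⟩ := hbounds t ht.1 x
    rwa [abs_of_nonneg (hσ₀.le.trans hlower)]
  bdd_x := by
    obtain ⟨C, hC⟩ := hσ.exists_abs_dx_le
    exact ⟨C, fun t ht => hC t ht.1⟩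

theorem IsNonnegSolution.sumCLM_densityVec_eq (hp : IsNonnegSolution T ε f σ p)
    (hq : IsNonnegSolution T ε f σ q) (hε : 0 < ε) (hf : ∀ n, 0 < f n) (hσ : SpaceRegular T σ)
    {σ₀ : ℝ} (hσ₀ : 0 < σ₀) (hlower : ∀ t ∈ Icc 0 T, ∀ x, σ₀ ≤ σ t x)
    (h₀ : ∀ n x, p n 0 x = q n 0 x) {t : ℝ} (ht : t ∈ Icc 0 T) (x : ℝ) :
    sumCLM N (densityVec p t x) = sumCLM N (densityVec q t x) := by
  have htotal : ∀ {r}, IsNonnegSolution T ε f σ r → IsBoundedSolution T (diffusion σ) (drift σ) id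
      fun t x => sumCLM N (densityVec r t x) := fun hr =>
    (hr.isBoundedSolution hε hf hσ).map _
      (fun t ht x =>
        (contDiffAt_nonlin (hr.denom_densityVec_pos hε hf ht x).ne').differentiableAt two_ne_zero)
      fun t ht x => sumCLM_comp_nonlin_eventuallyEq (hr.denom_densityVec_pos hε hf ht x).ne'
  obtain ⟨a₀, ha₀, a₁, ha⟩ := hσ.exists_diffusion_mem_Icc hσ₀ hlower
  obtain ⟨b₁, hb⟩ := hσ.exists_abs_drift_le
  refine congr_fun ((htotal hp).eq_of_linear (htotal hq) ha₀ ha hb ?_ ht) x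
  simp only [densityVec, h₀]

theorem sum_deriv_densityVec_sub_eq_zero {t : ℝ} (hp : ∀ n, Differentiable ℝ (p n t))
    (hq : ∀ n, Differentiable ℝ (q n t))
    (h : ∀ x, sumCLM N (densityVec p t x) = sumCLM N (densityVec q t x)) (x : ℝ) :
    ∑ n, (deriv (densityVec p t) x - deriv (densityVec q t) x) n = 0 := by
  rw [← sumCLM_apply, map_sub, ← deriv_clm_comp _ (differentiable_densityVec hp x),
    ← deriv_clm_comp _ (differentiable_densityVec hq x), funext h, sub_self]

theorem IsNonnegSolution.densityVec_mem_orthantBall (hp : IsNonnegSolution T ε f σ p) {M t x : ℝ}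
    (ht : t ∈ Icc 0 T) (hM : ‖densityVec p t x‖ ≤ M) : densityVec p t x ∈ orthantBall N M :=
  ⟨mem_closedBall_zero_iff.2 hM, fun n => hp.nonneg n t ht x⟩

end System

end LSV

open LSV in
theorem mainTheorem4_general {N : ℕ} {f : Fin N → ℝ} (hf : ∀ n, 0 < f n)
    (hvertex : ∀ k, √((∑ n ∈ Finset.univ.erase k, f n) * ∑ n ∈ Finset.univ.erase k, 1 / f n)
      ≤ N + 1)
    (hvariance : √(∑ n, (f n - fbar f) ^ 2) ≤ fmin f) {T ε : ℝ} (hε : 0 < ε) {σ : ℝ → ℝ → ℝ}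
    (hσ : SpaceRegular T σ) {σ₀ : ℝ} (hσ₀ : 0 < σ₀) (hlower : ∀ t ∈ Set.Icc 0 T, ∀ x, σ₀ ≤ σ t x)
    {p q : Fin N → ℝ → ℝ → ℝ} (hp : IsNonnegSolution T ε f σ p) (hq : IsNonnegSolution T ε f σ q)
    (h₀ : ∀ n x, p n 0 x = q n 0 x) : ∀ n, ∀ t ∈ Set.Icc 0 T, ∀ x, p n t x = q n t x := by
  intro n t ht x
  obtain ⟨a₀, ha₀, a₁, ha⟩ := hσ.exists_diffusion_mem_Icc hσ₀ hlower
  obtain ⟨b₁, hb⟩ := hσ.exists_abs_drift_le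
  obtain ⟨M₁, hM₁⟩ := exists_bound_densityVec hp.regular
  obtain ⟨M₂, hM₂⟩ := exists_bound_densityVec hq.regular
  have hpK := fun t ht x =>
    hp.densityVec_mem_orthantBall ht ((hM₁ t ht x).1.trans (le_max_left M₁ M₂))
  have hqK := fun t ht x =>
    hq.densityVec_mem_orthantBall ht ((hM₂ t ht x).1.trans (le_max_right M₁ M₂))
  obtain ⟨c, hc, hcoer⟩ := exists_pos_le_inner_fderiv_nonlin hε hf hvertex hvariance
    (((norm_nonneg _).trans (hM₁ t ht x).1).trans (le_max_left M₁ M₂))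
  have hzero := fun t ht => sum_deriv_densityVec_sub_eq_zero
    (fun n => (hp.regular n).diff_x t ht) (fun n => (hq.regular n).diff_x t ht)
    fun x => hp.sumCLM_densityVec_eq hq hε hf hσ hσ₀ hlower h₀ ht x
  have heq := (hp.isBoundedSolution hε hf hσ).eq_of_coercive (hq.isBoundedSolution hε hf hσ)
    (isCompact_orthantBall N (max M₁ M₂)) (fun z hz => contDiffAt_nonlin (denom_pos hε hf hz.2).ne')
    hpK hqK ha₀ ha hb hc (fun t ht x => hcoer _ (hpK t ht x) _ (hzero t ht x))
    (by simp only [densityVec, h₀, funext_iff, implies_true]) ht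
  exact congr_arg (fun z : EuclideanSpace ℝ (Fin N) => z n) (congr_fun heq x)

theorem mainTheorem4 (N : ℕ) (hN : 2 ≤ N) (f : Fin N → ℝ) (hf : ∀ n, 0 < f n)
    (hcond : LSV.SmallRange f)
    (T ε α : ℝ) (hT : 0 < T) (hε : 0 < ε) (hα : α ∈ Set.Ioo (0 : ℝ) 1)
    (σ : ℝ → ℝ → ℝ) (hσ : LSV.VolatilityAssumption σ)
    (m : Fin N → ℝ) (P : Fin N → ℝ → ℝ) (hP : LSV.InitialDensities m P)
    (hPα : ∀ n, LSV.HolderTwo α (P n))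
    (p q : Fin N → ℝ → ℝ → ℝ)
    (hp : ∀ n, LSV.ParabolicHolder T (α / 2) (p n)) (hps : LSV.IsSolution T ε f σ m P p)
    (hq : ∀ n, LSV.ParabolicHolder T (α / 2) (q n)) (hqs : LSV.IsSolution T ε f σ m P q) :
    ∀ n, ∀ t ∈ Set.Icc 0 T, ∀ x : ℝ, p n t x = q n t x := by
  have : NeZero N := ⟨by omega⟩
  obtain ⟨σ₀, _, hσ₀, -, hbounds⟩ := hσ.bounds
  exact mainTheorem4_general hf (hcond.sqrt_sum_erase_le hf) (hcond.sqrt_sum_sub_fbar_sq_le hf) hε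
    (hσ.spaceRegular T) hσ₀ (fun t ht x => (hbounds t ht.1 x).1)
    (hps.isNonnegSolution fun n => (hp n).parabolicRegular)
    (hqs.isNonnegSolution fun n => (hq n).parabolicRegular)
    fun n x => (hps.init n x).trans (hqs.init n x).symm
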